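/- **Theorem (regular initial conflicts for rules with NACs).** *Setting.* Let $(\mathcal C,\mathcal M)$ be an $\mathcal M$-adhesive category with binary coproducts and a unique $\mathcal E'$-$\mathcal M$ pair factorization. Application conditions (ACs) over an object $P$ are generated by $\exists(a,c)$ (for $a:P\to X$ and $c$ an AC over $X$), negation and finite conjunction; $p:P\to G$ satisfies $\exists(a,c)$ iff there is $q:X\to G$ in $\mathcal M$ with $q\circ a=p$ and $q\models c$. Write $\exists a$ for $\exists(a,\mathrm{true})$. Two ACs over $P$ are equivalent if they are satisfied by the same morphisms $P\to G$, for all $G$. A rule is a span $L\hookleftarrow I\hookrightarrow R$ of $\mathcal M$-morphisms with an AC over $L$; transformations are double pushouts whose match satisfies this AC (in AC-disregarding, or plain, transformations the match need not satisfy it). *Finiteness.* Let $\mathrm{Fin}$ be a class of ("finite") objects closed under $\mathcal M$-subobjects and under pushouts along $\mathcal M$-morphisms, such that for $A,B\in\mathrm{Fin}$ every pair $A\to X\leftarrow B$ in $\mathcal E'$ has $X\in\mathrm{Fin}$ and there are, up to isomorphism, only finitely many such pairs (for example, the finite graphs in the category of typed graphs, with $\mathcal E'$ the jointly surjective pairs).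 *Symbolic transformation pairs.* For a morphism $b:P\to P'$ and an AC $c$ over $P$, $\mathrm{Shift}(b,c)$ is the AC over $P'$ that commutes with negation and conjunction and has $\mathrm{Shift}(b,\exists(a,c))=\bigvee_{(a',b')}\exists(a',\mathrm{Shift}(b',c))$, over a finite system of representatives, up to isomorphism, of the pairs $(a',b')\in\mathcal E'$ with $b'\in\mathcal M$ and $a'\circ b=b'\circ a$. For a span $p=(L\leftarrow I\to R)$ and an AC $c$ over $R$, $\mathrm{Left}(p,c)$ is the AC over $L$ that commutes with negation and conjunction and has $\mathrm{Left}(p,\exists(a,c))=\exists(b,\mathrm{Left}(Y\leftarrow Z\to X,c))$ if $I\to R\xrightarrow{a}X$ has a pushout complement $I\to Z\to X$, where $L\xrightarrow{b}Y\leftarrow Z$ is the pushout of $L\leftarrow I\to Z$, and $\mathrm{Left}(p,\exists(a,c))=\mathrm{false}$ otherwise. For rules $\rho_1,\rho_2$ with ACs $ac_{L_1},ac_{L_2}$, a symbolic transformation pair $\langle tp_K,ac_K,ac^*_K\rangle$ consists of a pair $tp_K$ of AC-disregarding transformations of an object $K$, with matches $o_i:L_i\to K$ and derived spans $K\xleftarrow{k_i}D_i\xrightarrow{c_i}P_i$,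 and of the ACs $ac_K=\mathrm{Shift}(o_1,ac_{L_1})\wedge \mathrm{Shift}(o_2,ac_{L_2})$ and $ac^*_K=\neg(u_{12}\wedge u_{21})$ over $K$. Here $u_{12}=\mathrm{Left}(K\xleftarrow{k_2}D_2\xrightarrow{c_2}P_2,\ \mathrm{Shift}(c_2\circ d_{12},ac_{L_1}))$ if there is $d_{12}:L_1\to D_2$ with $k_2\circ d_{12}=o_1$, and $u_{12}=\mathrm{false}$ otherwise; $u_{21}$ is defined symmetrically. *Initial conflicts.* A transformation pair is parallel independent if there are $d_{12}:L_1\to D_2$ and $d_{21}:L_2\to D_1$ with $k_2\circ d_{12}=o_1$, $k_1\circ d_{21}=o_2$, $c_2\circ d_{12}\models ac_{L_1}$ and $c_1\circ d_{21}\models ac_{L_2}$, and it is a conflict otherwise (for plain rules, the ACs are ignored). One transformation pair is embedded into another by an extension morphism between the transformed objects that underlies extension diagrams (all of whose squares are pushouts) for both transformations. A plain transformation pair $tp^I$ embedded into $tp$ is initial for $tp$ if for every pair $tp'$ embedded into $tp$ there is a unique embedding of $tp^I$ into $tp'$ compatible with the two extension morphisms into $tp$. A plain initial conflict is a plain conflict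 that is isomorphic to an initial transformation pair for it. An initial conflict for $\rho_1,\rho_2$ is a symbolic transformation pair $\langle tp_K,ac_K,ac_K^*\rangle$ such that $tp_K$ embeds into some transformation pair for $\rho_1,\rho_2$ (with ACs satisfied) that is in conflict, and such that $tp_K$ is either a plain initial conflict or is parallel independent as a plain pair and isomorphic to the pair $R_1+L_2\Leftarrow L_1+L_2\Rightarrow L_1+R_2$ whose matches are the coproduct injections. It is called regular if $ac_K\wedge ac^*_K$ is equivalent to a finite nonempty disjunction $\bigvee_{i\in I}\exists\bigl(a_i:K\to C_i,\ \bigwedge_{j\in J_i}\neg\exists(b_{ij},d_{ij})\bigr)$ with finite sets $J_i$, non-isomorphisms $b_{ij}:C_i\to C_{ij}$ and ACs $d_{ij}$ over $C_{ij}$. *Statement.* Let $\mathcal R$ be a set of rules such that every conflict between transformations via the underlying plain rules of two rules of $\mathcal R$ has an initial transformation pair. Let $\rho_1,\rho_2\in\mathcal R$ be rules with $ac_{L_i}=\bigwedge_{j\in J_i}\neg\exists(n_{ij}:L_i\to N_{ij})$, $J_i$ finite, for $i=1,2$, and suppose that $L_i$, $R_i$ and all $N_{ij}$ belong to $\mathrm{Fin}$.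 Then every initial conflict $\langle tp_K,ac_K,ac_K^*\rangle$ for $\rho_1,\rho_2$ is regular. More precisely, $ac_K\wedge ac_K^*$ is equivalent to a disjunction $$\bigvee_{i\in I}\exists\Bigl(a_i:K\to C_i,\ \bigwedge_{q\in Q_i}\neg\exists\,n_q\Bigr)$$ with $I$ finite and nonempty, each $Q_i$ finite, and all $n_q$ (for $q\in Q_i$) non-isomorphisms with domain $C_i$. -/

import Mathlib

open CategoryTheory CategoryTheory.Limits

universe u v

namespace MAdhesive

section

variable {C : Type u} [Category.{v} C]

/-! ### Adhesive categories with a distinguished class of monomorphisms -/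

/-- `(C, M)` is an `M`-adhesive category: `M` is a class of monomorphisms that contains the
isomorphisms and is closed under composition and decomposition, pushouts and pullbacks along
`M`-morphisms exist, `M` is closed under pushouts and pullbacks, and every pushout along an
`M`-morphism is a van Kampen square for cubes with vertical morphisms in `M`. -/
structure IsMAdhesive (M : MorphismProperty C) : Prop where
  mono : ∀ ⦃A B : C⦄ (f : A ⟶ B), M f → Mono f
  iso : ∀ ⦃A B : C⦄ (f : A ⟶ B), IsIso f → M f
  comp : ∀ ⦃A B X : C⦄ (f : A ⟶ B) (g : B ⟶ X), M f → M g → M (f ≫ g)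
  decomp : ∀ ⦃A B X : C⦄ (f : A ⟶ B) (g : B ⟶ X), M (f ≫ g) → M g → M f
  hasPushout : ∀ ⦃W A B : C⦄ (f : W ⟶ A) (g : W ⟶ B), M f → HasPushout f g
  hasPullback : ∀ ⦃A B Z : C⦄ (f : A ⟶ Z) (g : B ⟶ Z), M f → HasPullback f g
  pushout : ∀ ⦃W A B Z : C⦄ {f : W ⟶ A} {g : W ⟶ B} {h : A ⟶ Z} {i : B ⟶ Z},
    IsPushout f g h i → M f → M i
  pullback : ∀ ⦃W A B Z : C⦄ {f : W ⟶ A} {g : W ⟶ B} {h : A ⟶ Z} {i : B ⟶ Z},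
    IsPullback f g h i → M h → M g
  vanKampen : ∀ ⦃W A B Z : C⦄ {f : W ⟶ A} {g : W ⟶ B} {h : A ⟶ Z} {i : B ⟶ Z},
    IsPushout f g h i → M f →
    ∀ ⦃W' A' B' Z' : C⦄ (f' : W' ⟶ A') (g' : W' ⟶ B') (h' : A' ⟶ Z') (i' : B' ⟶ Z')
      (αW : W' ⟶ W) (αA : A' ⟶ A) (αB : B' ⟶ B) (αZ : Z' ⟶ Z),
      M αA → M αB → M αZ →
      IsPullback f' αW αA f → IsPullback g' αW αB g →
      CommSq h' αA αZ h → CommSq i' αB αZ i → CommSq f' g' h' i' →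
      (IsPushout f' g' h' i' ↔ IsPullback h' αA αZ h ∧ IsPullback i' αB αZ i)

/-- A class of pairs of morphisms with a common codomain. -/
abbrev PairClass (C : Type u) [Category.{v} C] : Type (max u v) :=
  ∀ ⦃A B X : C⦄, (A ⟶ X) → (B ⟶ X) → Prop

/-- Unique `E'`-`M` pair factorization: every pair of morphisms with common codomain is a pair in
`E'` followed by a morphism in `M`, uniquely up to isomorphism. -/
structure HasUniquePairFactorization (M : MorphismProperty C) (E' : PairClass C) : Prop where
  exists_fac : ∀ ⦃A B Z : C⦄ (f : A ⟶ Z) (g : B ⟶ Z),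
    ∃ (X : C) (e₁ : A ⟶ X) (e₂ : B ⟶ X) (m : X ⟶ Z),
      E' e₁ e₂ ∧ M m ∧ e₁ ≫ m = f ∧ e₂ ≫ m = g
  unique_fac : ∀ ⦃A B Z X Y : C⦄ (e₁ : A ⟶ X) (e₂ : B ⟶ X) (m : X ⟶ Z)
    (e₁' : A ⟶ Y) (e₂' : B ⟶ Y) (m' : Y ⟶ Z),
    E' e₁ e₂ → M m → E' e₁' e₂' → M m' → e₁ ≫ m = e₁' ≫ m' → e₂ ≫ m = e₂' ≫ m' →
    ∃ φ : X ≅ Y, e₁ ≫ φ.hom = e₁' ∧ e₂ ≫ φ.hom = e₂' ∧ φ.hom ≫ m' = m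

/-- `fin` is a class of finite objects for `(C, M, E')`: it is closed under `M`-subobjects, under
pushouts along `M`-morphisms and under `E'`-overlaps, and two objects of the class have only
finitely many `E'`-overlaps up to isomorphism. -/
structure IsFinitenessClass (M : MorphismProperty C) (E' : PairClass C)
    (fin : ObjectProperty C) : Prop where
  subobject : ∀ ⦃A B : C⦄ (f : A ⟶ B), M f → fin B → fin A
  pushout : ∀ ⦃W A B Z : C⦄ {f : W ⟶ A} {g : W ⟶ B} {h : A ⟶ Z} {i : B ⟶ Z},
    IsPushout f g h i → M f → fin A → fin B → fin Z
  overlap : ∀ ⦃A B X : C⦄ (e₁ : A ⟶ X) (e₂ : B ⟶ X), E' e₁ e₂ → fin A → fin B → fin X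
  finite_overlaps : ∀ ⦃A B : C⦄, fin A → fin B →
    ∃ (n : ℕ) (X : Fin n → C) (e₁ : ∀ k, A ⟶ X k) (e₂ : ∀ k, B ⟶ X k),
      (∀ k, E' (e₁ k) (e₂ k)) ∧
      ∀ ⦃Y : C⦄ (f₁ : A ⟶ Y) (f₂ : B ⟶ Y), E' f₁ f₂ →
        ∃ (k : Fin n) (φ : X k ≅ Y), e₁ k ≫ φ.hom = f₁ ∧ e₂ k ≫ φ.hom = f₂

/-! ### Application conditions -/

/-- Nested application conditions over an object, with finite conjunctions. -/
inductive AC : C → Type (max u v)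
  | ex {P X : C} (a : P ⟶ X) (c : AC X) : AC P
  | neg {P : C} (c : AC P) : AC P
  | conj {P : C} (n : ℕ) (c : Fin n → AC P) : AC P

namespace AC

/-- The condition `true`: the empty conjunction. -/
def tt (P : C) : AC P := conj 0 Fin.elim0

/-- The condition `false`. -/
def ff (P : C) : AC P := neg (tt P)

/-- Binary conjunction. -/
def and {P : C} (c d : AC P) : AC P := conj 2 ![c, d]

/-- Finite disjunction. -/
def disj {P : C} (n : ℕ) (c : Fin n → AC P) : AC P := neg (conj n fun i => neg (c i))

/-- The negative application condition `¬∃a`. -/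
def nac {P X : C} (a : P ⟶ X) : AC P := neg (ex a (tt X))

/-- Satisfaction of an application condition over `P` by a morphism `P ⟶ G`. -/
def Sat (M : MorphismProperty C) {G : C} : ∀ {P : C}, AC P → (P ⟶ G) → Prop
  | _, ex (X := X) a c, p => ∃ q : X ⟶ G, M q ∧ a ≫ q = p ∧ Sat M c q
  | _, neg c, p => ¬ Sat M c p
  | _, conj _ c, p => ∀ i, Sat M (c i) p

/-- Equivalence of application conditions: they are satisfied by the same morphisms. -/
def Equivalent (M : MorphismProperty C) {P : C} (c d : AC P) : Prop :=
  ∀ ⦃G : C⦄ (p : P ⟶ G), Sat M c p ↔ Sat M d p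

end AC

/-- The commutative squares `b ≫ inl = a ≫ inr` with `(inl, inr)` in `E'` and `inr` in `M`. -/
structure Overlap (M : MorphismProperty C) (E' : PairClass C) {P P' X : C}
    (b : P ⟶ P') (a : P ⟶ X) where
  pt : C
  inl : P' ⟶ pt
  inr : X ⟶ pt
  mem : E' inl inr
  mem_M : M inr
  comm : b ≫ inl = a ≫ inr

/-- `IsShift M E' c b s`: the condition `s` over `P'` is a shift of the condition `c` over `P`
along `b : P ⟶ P'`.  A condition `∃(a, c)` is shifted to the disjunction of the conditions
`∃(a', Shift(b', c))` over a finite system of representatives, up to isomorphism, of the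
overlaps `(a', b')` of `b` and `a`; negation and conjunction are shifted componentwise. -/
def IsShift (M : MorphismProperty C) (E' : PairClass C) :
    ∀ {P : C}, AC P → ∀ {P' : C}, (P ⟶ P') → AC P' → Prop
  | _, .ex a c, _, b, s =>
      ∃ (n : ℕ) (o : Fin n → Overlap M E' b a),
        (∀ o' : Overlap M E' b a, ∃ (k : Fin n) (φ : (o k).pt ≅ o'.pt),
          (o k).inl ≫ φ.hom = o'.inl ∧ (o k).inr ≫ φ.hom = o'.inr) ∧
        ∃ t : ∀ k, AC (o k).pt, (∀ k, IsShift M E' c (o k).inr (t k)) ∧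
          s = AC.disj n fun k => AC.ex (o k).inl (t k)
  | _, .neg c, _, b, s => ∃ t, IsShift M E' c b t ∧ s = AC.neg t
  | _, .conj n c, _, b, s =>
      ∃ t : Fin n → AC _, (∀ i, IsShift M E' (c i) b (t i)) ∧ s = AC.conj n t

/-- `IsLeft c l r s`: the condition `s` over `L` is a translation of the condition `c` over `R`
along the rule `L ⟵l I ⟶r R`.  A condition `∃(a : R ⟶ X, c)` is translated to
`∃(b : L ⟶ Y, t)` if `(r, a)` has a pushout complement `I ⟶ Z ⟶ X`, where `L ⟶ Y ⟵ Z` is a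
pushout of `L ⟵ I ⟶ Z` and `t` is a translation of `c` along the derived rule `Y ⟵ Z ⟶ X`; and to
`false` if there is no pushout complement. -/
def IsLeft : ∀ {R : C}, AC R → ∀ {I L : C}, (I ⟶ L) → (I ⟶ R) → AC L → Prop
  | _, .ex (X := X) a c, I, L, l, r, s =>
      (∃ (Z Y : C) (z : I ⟶ Z) (r' : Z ⟶ X) (l' : Z ⟶ Y) (b : L ⟶ Y) (t : AC Y),
        IsPushout r z a r' ∧ IsPushout l z b l' ∧ IsLeft c l' r' t ∧ s = AC.ex b t) ∨
      ((¬ ∃ (Z : C) (z : I ⟶ Z) (r' : Z ⟶ X), IsPushout r z a r') ∧ s = AC.ff L)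
  | _, .neg c, _, _, l, r, s => ∃ t, IsLeft c l r t ∧ s = AC.neg t
  | _, .conj n c, _, L, l, r, s =>
      ∃ t : Fin n → AC L, (∀ i, IsLeft (c i) l r (t i)) ∧ s = AC.conj n t

/-! ### Rules and transformations -/

/-- A plain rule `L ⟵l I ⟶r R` with `l` and `r` in `M`. -/
structure PlainRule (M : MorphismProperty C) where
  L : C
  I : C
  R : C
  l : I ⟶ L
  r : I ⟶ R
  l_mem : M l
  r_mem : M r

/-- A rule: a plain rule with an application condition over its left-hand side. -/
structure Rule (M : MorphismProperty C) extends PlainRule M where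
  ac : AC L

variable {M : MorphismProperty C}

/-- A plain (that is, AC-disregarding) direct transformation of `G` via the plain rule `p`: a
double pushout with match `o`, comatch `o'` and derived span `G ⟵k D ⟶c H`. -/
structure Step (p : PlainRule M) (G : C) where
  D : C
  H : C
  o : p.L ⟶ G
  i : p.I ⟶ D
  o' : p.R ⟶ H
  k : D ⟶ G
  c : D ⟶ H
  left : IsPushout p.l i o k
  right : IsPushout p.r i o' c

/-- A pair of plain (AC-disregarding) direct transformations of the same object. -/
structure TransformationPair (p₁ p₂ : PlainRule M) where
  G : C
  t₁ : Step p₁ G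
  t₂ : Step p₂ G

/-- An extension diagram from a direct transformation of `G` to a direct transformation of `G'` via
the same rule, with extension morphism `f : G ⟶ G'`. -/
structure StepExtension {p : PlainRule M} {G G' : C} (t : Step p G) (t' : Step p G')
    (f : G ⟶ G') where
  d : t.D ⟶ t'.D
  h : t.H ⟶ t'.H
  match_comm : t.o ≫ f = t'.o
  interface_comm : t.i ≫ d = t'.i
  comatch_comm : t.o' ≫ h = t'.o'
  left : IsPushout t.k d f t'.k
  right : IsPushout t.c d h t'.c

/-- An embedding of a transformation pair into another one: an extension morphism with an extension
diagram for each of the two transformations. -/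
structure Embedding {p₁ p₂ : PlainRule M} (tp tp' : TransformationPair p₁ p₂) where
  f : tp.G ⟶ tp'.G
  ext₁ : StepExtension tp.t₁ tp'.t₁ f
  ext₂ : StepExtension tp.t₂ tp'.t₂ f

namespace TransformationPair

variable {p₁ p₂ : PlainRule M}

/-- Isomorphism of transformation pairs: an embedding all of whose morphisms are isomorphisms. -/
def Isomorphic (tp tp' : TransformationPair p₁ p₂) : Prop :=
  ∃ ε : Embedding tp tp', IsIso ε.f ∧ IsIso ε.ext₁.d ∧ IsIso ε.ext₁.h ∧
    IsIso ε.ext₂.d ∧ IsIso ε.ext₂.h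

/-- Parallel independence of a transformation pair via plain rules. -/
def PlainIndependent (tp : TransformationPair p₁ p₂) : Prop :=
  (∃ d₁₂ : p₁.L ⟶ tp.t₂.D, d₁₂ ≫ tp.t₂.k = tp.t₁.o) ∧
  (∃ d₂₁ : p₂.L ⟶ tp.t₁.D, d₂₁ ≫ tp.t₁.k = tp.t₂.o)

/-- `tpI`, embedded into `tp` by `ε`, is an initial transformation pair for `tp`. -/
def IsInitial {tpI tp : TransformationPair p₁ p₂} (ε : Embedding tpI tp) : Prop :=
  ∀ (tp' : TransformationPair p₁ p₂) (φ : Embedding tp' tp),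
    ∃! ψ : Embedding tpI tp', ψ.f ≫ φ.f = ε.f

/-- An initial conflict for plain rules: a transformation pair in conflict that is isomorphic to an
initial transformation pair for it. -/
def IsPlainInitialConflict (tp : TransformationPair p₁ p₂) : Prop :=
  ¬ tp.PlainIndependent ∧
    ∃ (tpI : TransformationPair p₁ p₂) (ε : Embedding tpI tp), IsInitial ε ∧ tp.Isomorphic tpI

end TransformationPair

/-- The plain rules underlying a set of rules have initial transformation pairs for conflicts. -/
def HasInitialPairsForConflicts (𝓡 : Set (Rule M)) : Prop :=
  ∀ ρ₁ ∈ 𝓡, ∀ ρ₂ ∈ 𝓡, ∀ tp : TransformationPair ρ₁.toPlainRule ρ₂.toPlainRule,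
    ¬ tp.PlainIndependent →
      ∃ (tpI : TransformationPair ρ₁.toPlainRule ρ₂.toPlainRule) (ε : Embedding tpI tp),
        TransformationPair.IsInitial ε

/-! ### The initial parallel independent transformation pair -/

section Coproduct

variable [HasBinaryCoproducts C]

theorem isPushout_coprod_inl {A B : C} (f : A ⟶ B) (X : C) :
    IsPushout f (coprod.inl : A ⟶ A ⨿ X) (coprod.inl : B ⟶ B ⨿ X) (coprod.map f (𝟙 X)) := by
  have w : f ≫ (coprod.inl : B ⟶ B ⨿ X) = coprod.inl ≫ coprod.map f (𝟙 X) := by simp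
  refine ⟨⟨w⟩, ⟨PushoutCocone.isColimitAux' _ fun s => ?_⟩⟩
  refine ⟨coprod.desc s.inl (coprod.inr ≫ s.inr), coprod.inl_desc _ _, ?_, ?_⟩
  · refine (coprod.map_desc _ _ _ _).trans (coprod.hom_ext ?_ ?_)
    · exact (coprod.inl_desc _ _).trans s.condition
    · exact (coprod.inr_desc _ _).trans (Category.id_comp _)
  · intro m h₁ h₂
    refine coprod.hom_ext (h₁.trans (coprod.inl_desc _ _).symm) ?_
    refine Eq.trans ?_ (coprod.inr_desc _ _).symm
    rw [← h₂]
    exact ((coprod.inr_map_assoc f (𝟙 X) m).trans (Category.id_comp _)).symm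

theorem isPushout_coprod_inr {A B : C} (f : A ⟶ B) (X : C) :
    IsPushout f (coprod.inr : A ⟶ X ⨿ A) (coprod.inr : B ⟶ X ⨿ B) (coprod.map (𝟙 X) f) := by
  have w : f ≫ (coprod.inr : B ⟶ X ⨿ B) = coprod.inr ≫ coprod.map (𝟙 X) f := by simp
  refine ⟨⟨w⟩, ⟨PushoutCocone.isColimitAux' _ fun s => ?_⟩⟩
  refine ⟨coprod.desc (coprod.inl ≫ s.inr) s.inl, coprod.inr_desc _ _, ?_, ?_⟩
  · refine (coprod.map_desc _ _ _ _).trans (coprod.hom_ext ?_ ?_)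
    · exact (coprod.inl_desc _ _).trans (Category.id_comp _)
    · exact (coprod.inr_desc _ _).trans s.condition
  · intro m h₁ h₂
    refine coprod.hom_ext ?_ (h₁.trans (coprod.inr_desc _ _).symm)
    refine Eq.trans ?_ (coprod.inl_desc _ _).symm
    rw [← h₂]
    exact ((coprod.inl_map_assoc (𝟙 X) f m).trans (Category.id_comp _)).symm

/-- The transformation pair `R₁ + L₂ ⟸ L₁ + L₂ ⟹ L₁ + R₂` whose matches are the coproduct
injections. -/
noncomputable def coproductPair (p₁ p₂ : PlainRule M) : TransformationPair p₁ p₂ where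
  G := p₁.L ⨿ p₂.L
  t₁ :=
    { D := p₁.I ⨿ p₂.L
      H := p₁.R ⨿ p₂.L
      o := coprod.inl
      i := coprod.inl
      o' := coprod.inl
      k := coprod.map p₁.l (𝟙 _)
      c := coprod.map p₁.r (𝟙 _)
      left := isPushout_coprod_inl _ _
      right := isPushout_coprod_inl _ _ }
  t₂ :=
    { D := p₁.L ⨿ p₂.I
      H := p₁.L ⨿ p₂.R
      o := coprod.inr
      i := coprod.inr
      o' := coprod.inr
      k := coprod.map (𝟙 _) p₂.l
      c := coprod.map (𝟙 _) p₂.r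
      left := isPushout_coprod_inr _ _
      right := isPushout_coprod_inr _ _ }

/-- An initial parallel independent transformation pair for plain rules. -/
def TransformationPair.IsInitialIndependent {p₁ p₂ : PlainRule M}
    (tp : TransformationPair p₁ p₂) : Prop :=
  tp.PlainIndependent ∧ tp.Isomorphic (coproductPair p₁ p₂)

end Coproduct

/-! ### Transformation pairs via rules with application conditions -/

/-- The two matches satisfy the application conditions of the rules, so that the AC-disregarding
pair is a transformation pair for the rules with application conditions. -/
def SatisfiesACs {ρ₁ ρ₂ : Rule M}
    (tp : TransformationPair ρ₁.toPlainRule ρ₂.toPlainRule) : Prop :=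
  AC.Sat M ρ₁.ac tp.t₁.o ∧ AC.Sat M ρ₂.ac tp.t₂.o

/-- Parallel independence for rules with application conditions. -/
def ParallelIndependent {ρ₁ ρ₂ : Rule M}
    (tp : TransformationPair ρ₁.toPlainRule ρ₂.toPlainRule) : Prop :=
  (∃ d₁₂ : ρ₁.L ⟶ tp.t₂.D, d₁₂ ≫ tp.t₂.k = tp.t₁.o ∧ AC.Sat M ρ₁.ac (d₁₂ ≫ tp.t₂.c)) ∧
  (∃ d₂₁ : ρ₂.L ⟶ tp.t₁.D, d₂₁ ≫ tp.t₁.k = tp.t₂.o ∧ AC.Sat M ρ₂.ac (d₂₁ ≫ tp.t₁.c))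

/-- `u` is the component of the conflict-inducing condition that belongs to a match `o : L ⟶ K`
with application condition `ac` and to the derived span `K ⟵k D ⟶c P` of the other
transformation: `Left(K ⟵ D ⟶ P, Shift(d ≫ c, ac))` if there is `d : L ⟶ D` with `d ≫ k = o`, and
`false` otherwise. -/
def IsConflictComponent (M : MorphismProperty C) (E' : PairClass C) {L K D P : C} (ac : AC L)
    (o : L ⟶ K) (k : D ⟶ K) (c : D ⟶ P) (u : AC K) : Prop :=
  (∃ d : L ⟶ D, d ≫ k = o ∧ ∃ s : AC P, IsShift M E' ac (d ≫ c) s ∧ IsLeft s k c u) ∨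
  ((¬ ∃ d : L ⟶ D, d ≫ k = o) ∧ u = AC.ff K)

/-- A symbolic transformation pair: an AC-disregarding transformation pair of `K` with its extension
condition `acK` and its conflict-inducing condition `acStar`. -/
structure SymbolicPair (E' : PairClass C) (ρ₁ ρ₂ : Rule M) where
  tp : TransformationPair ρ₁.toPlainRule ρ₂.toPlainRule
  acK : AC tp.G
  acStar : AC tp.G
  acK_spec : ∃ s₁ s₂ : AC tp.G, IsShift M E' ρ₁.ac tp.t₁.o s₁ ∧ IsShift M E' ρ₂.ac tp.t₂.o s₂ ∧
    acK = AC.and s₁ s₂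
  acStar_spec : ∃ u₁₂ u₂₁ : AC tp.G,
    IsConflictComponent M E' ρ₁.ac tp.t₁.o tp.t₂.k tp.t₂.c u₁₂ ∧
    IsConflictComponent M E' ρ₂.ac tp.t₂.o tp.t₁.k tp.t₁.c u₂₁ ∧
    acStar = AC.neg (AC.and u₁₂ u₂₁)

namespace SymbolicPair

variable {E' : PairClass C} {ρ₁ ρ₂ : Rule M}

/-- The unfolding: all transformation pairs (satisfying the application conditions of the rules) into
which the underlying AC-disregarding pair embeds. -/
def unfolding (stp : SymbolicPair E' ρ₁ ρ₂) :
    Set (TransformationPair ρ₁.toPlainRule ρ₂.toPlainRule) :=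
  {tp | SatisfiesACs tp ∧ Nonempty (Embedding stp.tp tp)}

/-- Some transformation pair of the unfolding is in conflict. -/
def ConflictInducing (stp : SymbolicPair E' ρ₁ ρ₂) : Prop :=
  ∃ tp ∈ stp.unfolding, ¬ ParallelIndependent tp

/-- Initial conflicts for rules with application conditions. -/
def IsInitialConflict [HasBinaryCoproducts C] (stp : SymbolicPair E' ρ₁ ρ₂) : Prop :=
  stp.ConflictInducing ∧ (stp.tp.IsPlainInitialConflict ∨ stp.tp.IsInitialIndependent)

/-- Regularity: `acK ∧ acStar` is equivalent to a finite nonempty disjunction of conditions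
`∃(a i, ⋀ j, ¬∃(b i j, d i j))` in which no `b i j` is an isomorphism. -/
def IsRegular (stp : SymbolicPair E' ρ₁ ρ₂) : Prop :=
  ∃ (n : ℕ) (X : Fin n → C) (a : ∀ i, stp.tp.G ⟶ X i) (J : Fin n → ℕ)
    (Y : ∀ i, Fin (J i) → C) (b : ∀ i j, X i ⟶ Y i j) (d : ∀ i j, AC (Y i j)),
    0 < n ∧ (∀ i j, ¬ IsIso (b i j)) ∧
    AC.Equivalent M (AC.and stp.acK stp.acStar)
      (AC.disj n fun i => AC.ex (a i) (AC.conj (J i) fun j => AC.neg (AC.ex (b i j) (d i j))))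

end SymbolicPair

end

end MAdhesive

namespace MAdhesive

section

variable {C : Type u} [Category.{v} C] {M : MorphismProperty C}

/-! ### Pushouts along `M`-morphisms -/

namespace IsMAdhesive

/-! Call a predicate on morphisms `p : P ⟶ G` finitely witnessed if it is a finite disjunction of
conditions `∃ a` with finite codomains. Since both application conditions are conjunctions of
conditions `¬∃ n`, the negations of all ingredients of a symbolic pair are finitely witnessed over
`K`: those of the two shifted conditions, because finite objects have finitely many overlaps, and
those of the conflict components, because `Left` turns an existential condition with finite codomain
into another one or into `false`. Hence `acK ∧ acStar` has the form `Φ ∧ ¬Ψ` with `Φ` (from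
`acStar`) and `Ψ` (the negation of `acK`) finitely witnessed.

Such a predicate has a regular form (`exists_regular_form`). For each witness `a` of `Φ`, shifting
`Ψ` along `a` gives finitely many morphisms `b` to be forbidden after `a`. If some `b` is an
isomorphism, the disjunct for `a` is unsatisfiable and is dropped. Some disjunct survives because
`acK ∧ acStar` is satisfiable: the extension morphism into a conflict of the unfolding satisfies it
(`SymbolicPair.exists_sat`).

All this needs `K` to be finite. A coproduct of finite objects is finite; for a plain initial
conflict, restricting to the joint image of the two matches gives an embedded pair on a finite
object, and initiality forces this image to be all of `K`. -/

theorem id_mem (hM : IsMAdhesive M) (A : C) : M (𝟙 A) := hM.iso _ inferInstance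

/-- Pushouts along `M`-morphisms are pullbacks. -/
theorem isPullback_of_isPushout (hM : IsMAdhesive M) {W A B Z : C} {f : W ⟶ A} {g : W ⟶ B}
    {h : A ⟶ Z} {i : B ⟶ Z} (sq : IsPushout f g h i) (hf : M f) : IsPullback g f i h := by
  have := hM.mono f hf
  -- The van Kampen cube has bottom `sq`, vertical morphisms `𝟙 W`, `f`, `𝟙 B`, `i`, and on top the
  -- trivial pushout of `g` along identities. One of its front faces is `sq` itself.
  exact ((hM.vanKampen sq hf (𝟙 W) g g (𝟙 B) (𝟙 W) f (𝟙 B) i hf (hM.id_mem B)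
    (hM.pushout sq hf) (IsKernelPair.id_of_mono f)
    (IsPullback.of_vert_isIso ⟨by simp⟩) ⟨sq.w.symm⟩ ⟨by simp⟩ ⟨by simp⟩).1
    (IsPushout.of_horiz_isIso ⟨by simp⟩)).1

/-- Decomposition of a pushout along an `M`-morphism whose right leg factors through an
`M`-morphism. -/
theorem exists_isPushout_of_comp (hM : IsMAdhesive M) {I R D H X : C} {r : I ⟶ R} {d : I ⟶ D}
    {h : R ⟶ H} {c : D ⟶ H} (sq : IsPushout r d h c) (hr : M r) (a : R ⟶ X) (q : X ⟶ H)
    (hq : M q) (w : a ≫ q = h) :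
    ∃ (Z : C) (z : I ⟶ Z) (r' : Z ⟶ X) (e : Z ⟶ D),
      z ≫ e = d ∧ M e ∧ IsPushout r z a r' ∧ IsPushout r' e q c := by
  have := hM.hasPullback q c hq
  have := hM.mono q hq
  have pb := IsPullback.of_hasPullback q c
  have he := hM.pullback pb hq
  have := hM.mono _ he
  have hw : (r ≫ a) ≫ q = d ≫ c := by rw [Category.assoc, w, sq.w]
  have hz : pb.lift (r ≫ a) d hw ≫ pullback.snd q c = d := pb.lift_snd _ _ _
  have hz' : pb.lift (r ≫ a) d hw ≫ pullback.fst q c = r ≫ a := pb.lift_fst _ _ _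
  refine ⟨Limits.pullback q c, pb.lift (r ≫ a) d hw, pullback.fst q c, pullback.snd q c, hz, he, ?_⟩
  have left : IsPushout r (pb.lift (r ≫ a) d hw) a (pullback.fst q c) := by
    -- The left square is the pullback of `sq` along `q`. The faces over `d` and `h` are pullbacks
    -- because `e` and `q` are monomorphisms.
    refine (hM.vanKampen sq hr r (pb.lift (r ≫ a) d hw) a (pullback.fst q c) (𝟙 _) (𝟙 _)
      (pullback.snd q c) q (hM.id_mem _) he hq (IsPullback.of_vert_isIso ⟨by simp⟩) ?_
      ⟨by simp [w]⟩ ⟨pb.w⟩ ⟨hz'.symm⟩).2 ⟨?_, pb⟩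
    · refine ⟨⟨by simp [hz]⟩, ⟨PullbackCone.IsLimit.mk _ (fun s => s.snd) (fun s => ?_)
        (fun s => by simp) (fun s m _ h₂ => by simpa using h₂)⟩⟩
      rw [← cancel_mono (pullback.snd q c), Category.assoc, hz, s.condition]
    · refine ⟨⟨by simp [w]⟩, ⟨PullbackCone.IsLimit.mk _ (fun s => s.snd) (fun s => ?_)
        (fun s => by simp) (fun s m _ h₂ => by simpa using h₂)⟩⟩
      rw [← cancel_mono q, Category.assoc, w, s.condition]
  refine ⟨left, ?_⟩
  refine IsPushout.of_left ?_ pb.w.symm left.flip |>.flip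
  rw [hz, w]; exact sq.flip

/-- Pushout complements along `M`-morphisms are unique: comparison morphism. -/
theorem exists_complement_hom (hM : IsMAdhesive M) {I R X Z Z' : C} {r : I ⟶ R} {a : R ⟶ X}
    {z : I ⟶ Z} {r' : Z ⟶ X} {z' : I ⟶ Z'} {r'' : Z' ⟶ X} (hr : M r)
    (sq : IsPushout r z a r') (sq' : IsPushout r z' a r'') :
    ∃ W : C, ∃ (w : I ⟶ W) (p : W ⟶ Z) (p' : W ⟶ Z'),
      IsIso p ∧ w ≫ p = z ∧ w ≫ p' = z' ∧ p ≫ r' = p' ≫ r'' := by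
  have hr' := hM.pushout sq hr
  have := hM.mono r hr
  have := hM.mono r' hr'
  have := hM.hasPullback r' r'' hr'
  have pb := IsPullback.of_hasPullback r' r''
  have hp' := hM.pullback pb hr'
  have := hM.mono _ hp'
  have hw : z ≫ r' = z' ≫ r'' := by rw [← sq.w, ← sq'.w]
  have h₁ : pb.lift z z' hw ≫ pullback.fst r' r'' = z := pb.lift_fst _ _ _
  have h₂ : pb.lift z z' hw ≫ pullback.snd r' r'' = z' := pb.lift_snd _ _ _
  -- Pulling `sq'` back along `r'` gives a pushout with an identity leg, so the opposite leg, the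
  -- projection to `Z`, is an isomorphism.
  have top : IsPushout (𝟙 I) (pb.lift z z' hw) z (pullback.fst r' r'') := by
    refine (hM.vanKampen sq' hr (𝟙 I) (pb.lift z z' hw) z (pullback.fst r' r'') (𝟙 I) r
      (pullback.snd r' r'') r' hr hp' hr' (IsKernelPair.id_of_mono r) ?_
      ⟨sq.w.symm⟩ ⟨pb.w⟩ ⟨by simp [h₁]⟩).2 ⟨hM.isPullback_of_isPushout sq hr, pb⟩
    refine ⟨⟨by simp [h₂]⟩, ⟨PullbackCone.IsLimit.mk _ (fun s => s.snd) (fun s => ?_)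
        (fun s => by simp) (fun s m _ h₂ => by simpa using h₂)⟩⟩
    rw [← cancel_mono (pullback.snd r' r''), Category.assoc, h₂, s.condition]
  refine ⟨_, pb.lift z z' hw, pullback.fst r' r'', pullback.snd r' r'', ?_, h₁, h₂, pb.w⟩
  exact top.isIso_inr_of_isIso

end IsMAdhesive

theorem exists_isPushout_of_isPushout {I R D H X Z : C} {r : I ⟶ R} {z : I ⟶ Z} {a : R ⟶ X}
    {r' : Z ⟶ X} {d : I ⟶ D} {h : R ⟶ H} {c : D ⟶ H} (sq : IsPushout r z a r')
    (sq' : IsPushout r d h c) (e : Z ⟶ D) (he : z ≫ e = d) :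
    ∃ q : X ⟶ H, a ≫ q = h ∧ IsPushout r' e q c := by
  have w : r ≫ h = z ≫ e ≫ c := by rw [sq'.w, ← he, Category.assoc]
  refine ⟨sq.desc h (e ≫ c) w, sq.inl_desc _ _ _, ?_⟩
  refine IsPushout.of_top ?_ (sq.inr_desc _ _ _) sq
  rw [he, sq.inl_desc]; exact sq'

/-- Pulling back along `q` produces some pushout complement of `r` and `a`; uniqueness of
complements transports the resulting decomposition to the given `Z`. -/
theorem IsMAdhesive.exists_isPushout_of_complement (hM : IsMAdhesive M) {I R D H X Z : C}
    {r : I ⟶ R} {z : I ⟶ Z} {a : R ⟶ X} {r' : Z ⟶ X} {d : I ⟶ D} {h : R ⟶ H} {c : D ⟶ H}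
    (hr : M r) (sq : IsPushout r z a r') (sq' : IsPushout r d h c) (q : X ⟶ H) (hq : M q)
    (w : a ≫ q = h) : ∃ e : Z ⟶ D, z ≫ e = d ∧ M e ∧ IsPushout r' e q c := by
  obtain ⟨Z', z', r'', e, hz', he, sq₁, sq₂⟩ := hM.exists_isPushout_of_comp sq' hr a q hq w
  obtain ⟨W, x, p, p', _, hp, hp', hpp⟩ := hM.exists_complement_hom hr sq sq₁
  have hxz : x = z ≫ inv p := by simp [← hp]
  have hze : z ≫ inv p ≫ p' ≫ e = d := by
    rw [← hz', ← hp', hxz]; simp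
  obtain ⟨q', hq', sq₃⟩ := exists_isPushout_of_isPushout sq sq' _ hze
  -- Both morphisms restrict to `h` on `R`, and the comparison of the two complements makes them
  -- agree on `Z`.
  have hqq : q' = q := by
    refine sq.hom_ext (hq'.trans w.symm) ?_
    rw [sq₃.w, Category.assoc, Category.assoc, ← sq₂.w, ← Category.assoc p', ← hpp]; simp
  subst hqq
  have := hM.mono q' hq
  have := hM.mono r' (hM.pushout sq hr)
  refine ⟨_, hze, ?_, sq₃⟩
  exact hM.pullback (hM.isPullback_of_isPushout sq₃ (hM.pushout sq hr)).flip hq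

/-! ### Shift and Left -/

namespace AC

theorem sat_and {P G : C} (c d : AC P) (p : P ⟶ G) :
    Sat M (AC.and c d) p ↔ Sat M c p ∧ Sat M d p := by
  simp [AC.and, Sat, Fin.forall_fin_two]

theorem sat_disj {P G : C} (n : ℕ) (c : Fin n → AC P) (p : P ⟶ G) :
    Sat M (disj n c) p ↔ ∃ i, Sat M (c i) p := by
  simp [disj, Sat]

theorem sat_tt {P G : C} (p : P ⟶ G) : Sat M (tt P) p := fun i => i.elim0

theorem sat_ff {P G : C} (p : P ⟶ G) : ¬ Sat M (ff P) p := fun h => h (sat_tt p)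

theorem sat_nac {P X G : C} (a : P ⟶ X) (p : P ⟶ G) :
    Sat M (nac a) p ↔ ¬ ∃ m : X ⟶ G, M m ∧ a ≫ m = p := by
  simp only [nac, Sat, sat_tt, and_true]

end AC

variable {E' : PairClass C}

/-- The pair factorization of `(p, q)` is the overlap: its second leg is in `M` by decomposition,
and the square commutes because `m` is mono. -/
theorem exists_overlap_fac (hM : IsMAdhesive M) (hE' : HasUniquePairFactorization M E')
    {P P' X G : C} (b : P ⟶ P') (a : P ⟶ X) (p : P' ⟶ G) (q : X ⟶ G) (hq : M q)
    (w : b ≫ p = a ≫ q) :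
    ∃ (o : Overlap M E' b a) (m : o.pt ⟶ G), M m ∧ o.inl ≫ m = p ∧ o.inr ≫ m = q := by
  obtain ⟨Y, e₁, e₂, m, he, hm, h₁, h₂⟩ := hE'.exists_fac p q
  have := hM.mono m hm
  refine ⟨⟨Y, e₁, e₂, he, hM.decomp e₂ m (h₂ ▸ hq) hm, ?_⟩, m, hm, h₁, h₂⟩
  rw [← cancel_mono m, Category.assoc, Category.assoc, h₁, h₂, w]

theorem IsShift.sat_iff (hM : IsMAdhesive M) (hE' : HasUniquePairFactorization M E')
    {P : C} {c : AC P} {P' : C} {b : P ⟶ P'} {s : AC P'} (h : IsShift M E' c b s)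
    {G : C} (p : P' ⟶ G) : AC.Sat M s p ↔ AC.Sat M c (b ≫ p) := by
  induction c generalizing P' G with
  | ex a c ih =>
    obtain ⟨n, o, ho, t, ht, rfl⟩ := h
    rw [AC.sat_disj]
    constructor
    · rintro ⟨k, m, hm, rfl, hs⟩
      refine ⟨(o k).inr ≫ m, hM.comp _ _ (o k).mem_M hm, ?_, (ih (ht k) m).1 hs⟩
      rw [← Category.assoc, ← (o k).comm, Category.assoc]
    · rintro ⟨q, hq, haq, hs⟩
      obtain ⟨o', m, hm, h₁, h₂⟩ := exists_overlap_fac hM hE' b a p q hq haq.symm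
      obtain ⟨k, φ, hφ₁, hφ₂⟩ := ho o'
      refine ⟨k, φ.hom ≫ m, hM.comp _ _ (hM.iso _ inferInstance) hm, ?_, ?_⟩
      · rw [← Category.assoc, hφ₁, h₁]
      · rw [ih (ht k), ← Category.assoc, hφ₂, h₂]
        exact hs
  | neg c ih =>
    obtain ⟨t, ht, rfl⟩ := h
    exact not_congr (ih ht p)
  | conj n c ih =>
    obtain ⟨t, ht, rfl⟩ := h
    exact forall_congr' fun i => ih i (ht i) p

/-- An `M`-morphism out of `X` or `Y` splits its side of the double pushout over `Z`. The morphism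
from `Z` to `D` obtained in this way splits the other side too, and the two remaining squares form
the double pushout for the inner condition. -/
theorem IsLeft.sat_iff (hM : IsMAdhesive M) {R : C} {c : AC R} {I L : C} {l : I ⟶ L}
    {r : I ⟶ R} {s : AC L} (h : IsLeft c l r s) (hl : M l) (hr : M r) {L' D R' : C}
    {f : L ⟶ L'} {d : I ⟶ D} {k : D ⟶ L'} {g : R ⟶ R'} {e : D ⟶ R'}
    (sql : IsPushout l d f k) (sqr : IsPushout r d g e) :
    AC.Sat M s f ↔ AC.Sat M c g := by
  induction c generalizing I L L' D R' with
  | ex a c ih =>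
    rcases h with ⟨Z, Y, z, r', l', b, t, sq₁, sq₂, ht, rfl⟩ | ⟨hno, rfl⟩
    · have hl' := hM.pushout sq₂ hl
      have hr' := hM.pushout sq₁ hr
      constructor
      · rintro ⟨m, hm, hbm, hs⟩
        obtain ⟨w, hzw, hw, sq₃⟩ := hM.exists_isPushout_of_complement hl sq₂ sql m hm hbm
        obtain ⟨q, haq, sq₄⟩ := exists_isPushout_of_isPushout sq₁ sqr w hzw
        exact ⟨q, hM.pushout sq₄.flip hw, haq, (ih ht hl' hr' sq₃ sq₄).1 hs⟩
      · rintro ⟨q, hq, haq, hs⟩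
        obtain ⟨w, hzw, hw, sq₄⟩ := hM.exists_isPushout_of_complement hr sq₁ sqr q hq haq
        obtain ⟨m, hbm, sq₃⟩ := exists_isPushout_of_isPushout sq₂ sql w hzw
        exact ⟨m, hM.pushout sq₃.flip hw, hbm, (ih ht hl' hr' sq₃ sq₄).2 hs⟩
    · refine iff_of_false (AC.sat_ff f) ?_
      rintro ⟨q, hq, haq, -⟩
      obtain ⟨Z, z, r', -, -, -, sq, -⟩ := hM.exists_isPushout_of_comp sqr hr a q hq haq
      exact hno ⟨Z, z, r', sq⟩
  | neg c ih =>
    obtain ⟨t, ht, rfl⟩ := h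
    exact not_congr (ih ht hl hr sql sqr)
  | conj n c ih =>
    obtain ⟨t, ht, rfl⟩ := h
    exact forall_congr' fun i => ih i (ht i) hl hr sql sqr

/-! ### Embeddings of transformation pairs -/

namespace Step

variable {p : PlainRule M} {G : C}

theorem k_mem (hM : IsMAdhesive M) (t : Step p G) : M t.k := hM.pushout t.left p.l_mem

theorem c_mem (hM : IsMAdhesive M) (t : Step p G) : M t.c := hM.pushout t.right p.r_mem

/-- A direct transformation restricts along an `M`-morphism through which its match factors. -/
theorem exists_restriction (hM : IsMAdhesive M) (t : Step p G) {X : C} (e : p.L ⟶ X)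
    (m : X ⟶ G) (hm : M m) (w : e ≫ m = t.o) :
    ∃ t' : Step p X, Nonempty (StepExtension t' t m) := by
  obtain ⟨D, i, k, d, hd, -, sq₁, sq₂⟩ := hM.exists_isPushout_of_comp t.left p.l_mem e m hm w
  have := hM.hasPushout p.r i p.r_mem
  have sq₃ := IsPushout.of_hasPushout p.r i
  obtain ⟨h, hh, sq₄⟩ := exists_isPushout_of_isPushout sq₃ t.right d hd
  exact ⟨⟨D, _, e, i, _, k, _, sq₁, sq₃⟩, ⟨⟨d, h, w, hd, hh, sq₂, sq₄⟩⟩⟩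

end Step

namespace StepExtension

variable {p : PlainRule M} {G G' G'' : C} {t : Step p G} {t' : Step p G'} {t'' : Step p G''}

/-- The identity extension diagram. -/
def refl (t : Step p G) : StepExtension t t (𝟙 G) where
  d := 𝟙 _
  h := 𝟙 _
  match_comm := by simp
  interface_comm := by simp
  comatch_comm := by simp
  left := IsPushout.of_vert_isIso ⟨by simp⟩
  right := IsPushout.of_vert_isIso ⟨by simp⟩

/-- Composition of extension diagrams. -/
def trans {f : G ⟶ G'} {f' : G' ⟶ G''} (ε : StepExtension t t' f)
    (ε' : StepExtension t' t'' f') : StepExtension t t'' (f ≫ f') where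
  d := ε.d ≫ ε'.d
  h := ε.h ≫ ε'.h
  match_comm := by rw [← Category.assoc, ε.match_comm, ε'.match_comm]
  interface_comm := by rw [← Category.assoc, ε.interface_comm, ε'.interface_comm]
  comatch_comm := by rw [← Category.assoc, ε.comatch_comm, ε'.comatch_comm]
  left := ε.left.paste_vert ε'.left
  right := ε.right.paste_vert ε'.right

/-- The inverse of an extension diagram all of whose morphisms are isomorphisms. -/
noncomputable def symm {f : G ⟶ G'} (ε : StepExtension t t' f) [IsIso f] [IsIso ε.d]
    [IsIso ε.h] : StepExtension t' t (inv f) where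
  d := inv ε.d
  h := inv ε.h
  match_comm := by simp [← ε.match_comm]
  interface_comm := by simp [← ε.interface_comm]
  comatch_comm := by simp [← ε.comatch_comm]
  left := IsPushout.of_vert_isIso ⟨by simp [← ε.left.w_assoc]⟩
  right := IsPushout.of_vert_isIso ⟨by simp [← ε.right.w_assoc]⟩

end StepExtension

namespace Embedding

variable {p₁ p₂ : PlainRule M} {tp tp' tp'' : TransformationPair p₁ p₂}

/-- The identity embedding. -/
def refl (tp : TransformationPair p₁ p₂) : Embedding tp tp :=
  ⟨𝟙 _, StepExtension.refl _, StepExtension.refl _⟩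

/-- Composition of embeddings. -/
def trans (ε : Embedding tp tp') (ε' : Embedding tp' tp'') : Embedding tp tp'' :=
  ⟨ε.f ≫ ε'.f, ε.ext₁.trans ε'.ext₁, ε.ext₂.trans ε'.ext₂⟩

end Embedding

namespace TransformationPair

variable {p₁ p₂ : PlainRule M} {tp tp' : TransformationPair p₁ p₂}

theorem Isomorphic.symm (h : tp.Isomorphic tp') : tp'.Isomorphic tp := by
  obtain ⟨ε, _, _, _, _, _⟩ := h
  refine ⟨⟨inv ε.f, ε.ext₁.symm, ε.ext₂.symm⟩, ?_⟩
  dsimp only [StepExtension.symm]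
  refine ⟨?_, ?_, ?_, ?_, ?_⟩ <;> infer_instance

/-- If an initial transformation pair for `tp` is isomorphic to `tp`, then it is embedded by an
isomorphism. -/
theorem IsInitial.isIso_f {ε : Embedding tp' tp} (hε : IsInitial ε) (h : tp.Isomorphic tp') :
    IsIso ε.f := by
  obtain ⟨δ, _, _⟩ := h
  -- By the uniqueness part of initiality, a self-embedding of `tp'` over `ε` is trivial on the
  -- transformed objects.
  have huniq : ∀ ψ : Embedding tp' tp', ψ.f ≫ ε.f = ε.f → ψ.f = 𝟙 _ := fun ψ hψ =>
    congrArg Embedding.f ((hε tp' ε).unique (y₁ := ψ) (y₂ := Embedding.refl _) hψ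
      (Category.id_comp _))
  -- Initiality is applied to `tp'` embedded by the detour `ε`, `δ`, `ε`; the resulting `ψ.f` is a
  -- two-sided inverse of `ε.f ≫ δ.f`.
  obtain ⟨ψ, hψ, -⟩ := hε tp' ((ε.trans δ).trans ε)
  have h₁ : ψ.f ≫ ε.f ≫ δ.f = 𝟙 _ := by
    have := huniq (ψ.trans (ε.trans δ)) (by simpa [Embedding.trans] using hψ)
    exact this
  have h₂ : (ε.f ≫ δ.f) ≫ ψ.f = 𝟙 _ := by
    refine huniq ((ε.trans δ).trans ψ) ?_
    rw [← cancel_mono δ.f]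
    simp [Embedding.trans, h₁]
  have : IsIso (ε.f ≫ δ.f) := ⟨ψ.f, h₂, h₁⟩
  exact IsIso.of_isIso_comp_right ε.f δ.f

end TransformationPair

/-! ### Finitely witnessed predicates -/

/-- The predicate `Φ` on morphisms out of `P` holds exactly for the morphisms that factor as a
member of a finite set of morphisms from `P` to finite objects, followed by an `M`-morphism. -/
def FinitelyWitnessed (M : MorphismProperty C) (fin : ObjectProperty C) {P : C}
    (Φ : ∀ ⦃G : C⦄, (P ⟶ G) → Prop) : Prop :=
  ∃ S : Set (Under P), S.Finite ∧ (∀ U ∈ S, fin U.right) ∧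
    ∀ ⦃G : C⦄ (p : P ⟶ G), Φ p ↔ ∃ U ∈ S, ∃ m : U.right ⟶ G, M m ∧ U.hom ≫ m = p

namespace FinitelyWitnessed

variable {fin : ObjectProperty C}

theorem of_morphism {P X : C} (a : P ⟶ X) (hX : fin X) :
    FinitelyWitnessed M fin fun G (p : P ⟶ G) => ∃ m : X ⟶ G, M m ∧ a ≫ m = p :=
  ⟨{Under.mk a}, Set.finite_singleton _, by rintro _ rfl; exact hX, fun G p => by simp⟩

theorem of_false {P : C} : FinitelyWitnessed M fin fun G (_ : P ⟶ G) => False :=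
  ⟨∅, Set.finite_empty, by simp, fun G p => by simp⟩

theorem congr {P : C} {Φ Ψ : ∀ ⦃G : C⦄, (P ⟶ G) → Prop} (h : FinitelyWitnessed M fin Φ)
    (hΦ : ∀ ⦃G : C⦄ (p : P ⟶ G), Ψ p ↔ Φ p) : FinitelyWitnessed M fin Ψ := by
  obtain ⟨S, hS, hfin, hs⟩ := h
  exact ⟨S, hS, hfin, fun G p => (hΦ p).trans (hs p)⟩

theorem exists_of_finite {P : C} {ι : Type*} [Finite ι] {Φ : ι → ∀ ⦃G : C⦄, (P ⟶ G) → Prop}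
    (h : ∀ i, FinitelyWitnessed M fin (Φ i)) :
    FinitelyWitnessed M fin fun _ p => ∃ i, Φ i p := by
  choose S hS hfin hs using h
  refine ⟨⋃ i, S i, Set.finite_iUnion hS, ?_, fun G p => ?_⟩
  · rintro U hU
    obtain ⟨i, hi⟩ := Set.mem_iUnion.1 hU
    exact hfin i U hi
  · simp only [hs, Set.mem_iUnion]
    exact ⟨fun ⟨i, U, hU, h⟩ => ⟨U, ⟨i, hU⟩, h⟩, fun ⟨U, ⟨i, hU⟩, h⟩ => ⟨i, U, hU, h⟩⟩

theorem or {P : C} {Φ Ψ : ∀ ⦃G : C⦄, (P ⟶ G) → Prop} (hΦ : FinitelyWitnessed M fin Φ)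
    (hΨ : FinitelyWitnessed M fin Ψ) : FinitelyWitnessed M fin fun _ p => Φ p ∨ Ψ p := by
  refine (exists_of_finite (ι := Bool) (Φ := fun b => bif b then Φ else Ψ)
    (by rintro (_ | _) <;> assumption)).congr fun G p => ?_
  simp [or_comm]

/-- Existential conditions shift to finitely witnessed predicates. -/
theorem shift (hM : IsMAdhesive M) (hE' : HasUniquePairFactorization M E')
    (hfin : IsFinitenessClass M E' fin) {P P' X : C} (b : P ⟶ P') (a : P ⟶ X) (hP' : fin P')
    (hX : fin X) :
    FinitelyWitnessed M fin fun G (p : P' ⟶ G) => ∃ m : X ⟶ G, M m ∧ a ≫ m = b ≫ p := by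
  obtain ⟨n, Y, e₁, e₂, he, hY⟩ := hfin.finite_overlaps hP' hX
  -- Only those representatives that are overlaps of `b` and `a` are kept.
  refine (exists_of_finite (ι := {k : Fin n // M (e₂ k) ∧ b ≫ e₁ k = a ≫ e₂ k}) fun k =>
    of_morphism (e₁ k) (hfin.overlap _ _ (he k) hP' hX)).congr fun G p => ?_
  constructor
  · rintro ⟨q, hq, hw⟩
    obtain ⟨o, m, hm, h₁, h₂⟩ := exists_overlap_fac hM hE' b a p q hq hw.symm
    obtain ⟨k, φ, hφ₁, hφ₂⟩ := hY o.inl o.inr o.mem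
    have hφ := hM.iso φ.inv inferInstance
    have e₁k : e₁ k = o.inl ≫ φ.inv := by rw [← hφ₁]; simp
    have e₂k : e₂ k = o.inr ≫ φ.inv := by rw [← hφ₂]; simp
    refine ⟨⟨k, ?_, ?_⟩, φ.hom ≫ m, hM.comp _ _ (hM.iso _ inferInstance) hm, ?_⟩
    · rw [e₂k]; exact hM.comp _ _ o.mem_M hφ
    · rw [e₁k, e₂k, ← Category.assoc, o.comm, Category.assoc]
    · rw [← Category.assoc, hφ₁, h₁]
  · rintro ⟨⟨k, hk, hw⟩, m, hm, rfl⟩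
    exact ⟨e₂ k ≫ m, hM.comp _ _ hk hm, by
      simpa only [Category.assoc] using congrArg (· ≫ m) hw.symm⟩

/-- A finite object has only finitely many quotients in the sense of pair factorizations, so that
the predicate `True` is finitely witnessed. -/
theorem of_true (hE' : HasUniquePairFactorization M E') (hM : IsMAdhesive M)
    (hfin : IsFinitenessClass M E' fin) {P : C} (hP : fin P) :
    FinitelyWitnessed M fin fun G (_ : P ⟶ G) => True := by
  obtain ⟨n, Y, e₁, e₂, he, hY⟩ := hfin.finite_overlaps hP hP
  refine (exists_of_finite fun k =>
    of_morphism (e₁ k) (hfin.overlap _ _ (he k) hP hP)).congr fun G p => ?_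
  -- Since `p` need not be in `M`, the identity of `P` is not enough as a witness; the pair `(p, p)`
  -- is factored instead.
  obtain ⟨X, f₁, f₂, m, hf, hm, h₁, -⟩ := hE'.exists_fac p p
  obtain ⟨k, φ, hφ, -⟩ := hY f₁ f₂ hf
  exact iff_of_true trivial
    ⟨k, φ.hom ≫ m, hM.comp _ _ (hM.iso _ inferInstance) hm, by rw [← Category.assoc, hφ, h₁]⟩

/-- The predicates that are satisfiable and of the form `Φ ∧ ¬Ψ` with `Φ` and `Ψ` finitely
witnessed are given by finite nonempty disjunctions of conditions `∃(a, ⋀ ¬∃ b)` in which no `b` is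
an isomorphism. -/
theorem exists_regular_form (hM : IsMAdhesive M) (hE' : HasUniquePairFactorization M E')
    (hfin : IsFinitenessClass M E' fin) {P : C} {Φ Ψ : ∀ ⦃G : C⦄, (P ⟶ G) → Prop}
    (hΦ : FinitelyWitnessed M fin Φ) (hΨ : FinitelyWitnessed M fin Ψ)
    (hsat : ∃ (G : C) (p : P ⟶ G), Φ p ∧ ¬ Ψ p) :
    ∃ (n : ℕ) (X : Fin n → C) (a : ∀ i, P ⟶ X i) (Q : Fin n → ℕ)
      (Y : ∀ i, Fin (Q i) → C) (b : ∀ i q, X i ⟶ Y i q),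
      0 < n ∧ (∀ i q, ¬ IsIso (b i q)) ∧
      ∀ ⦃G : C⦄ (p : P ⟶ G), (Φ p ∧ ¬ Ψ p) ↔
        AC.Sat M (AC.disj n fun i => AC.ex (a i)
          (AC.conj (Q i) fun q => AC.nac (b i q))) p := by
  obtain ⟨S, hS, hSfin, hS'⟩ := hΦ
  obtain ⟨T, hT, hTfin, hT'⟩ := hΨ
  have := hT.to_subtype
  have key : ∀ U : S, FinitelyWitnessed M fin fun G (p : U.1.right ⟶ G) => Ψ (U.1.hom ≫ p) :=
    fun U => (exists_of_finite fun V : T =>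
      shift hM hE' hfin U.1.hom V.1.hom (hSfin _ U.2) (hTfin _ V.2)).congr fun G p => by
        simp [hT']
  choose W hW _ hW' using key
  -- If `V.hom` is an isomorphism, every `m` in `M` factors through it by an `M`-morphism, so `¬∃
  -- V.hom` fails and the disjunct of `U` contributes nothing.
  let S' : Set S := {U | ∀ V ∈ W U, ¬ IsIso V.hom}
  have := hS.to_subtype
  have hform : ∀ ⦃G : C⦄ (p : P ⟶ G), (Φ p ∧ ¬ Ψ p) ↔ ∃ U : S', ∃ m : U.1.1.right ⟶ G,
      M m ∧ U.1.1.hom ≫ m = p ∧ ∀ V ∈ W U.1, ¬ ∃ q : V.right ⟶ G, M q ∧ V.hom ≫ q = m := by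
    intro G p
    constructor
    · rintro ⟨h₁, h₂⟩
      obtain ⟨U, hU, m, hm, rfl⟩ := (hS' p).1 h₁
      have h₃ : ∀ V ∈ W ⟨U, hU⟩, ¬ ∃ q : V.right ⟶ G, M q ∧ V.hom ≫ q = m := fun V hV hq =>
        h₂ ((hW' ⟨U, hU⟩ m).2 ⟨V, hV, hq⟩)
      refine ⟨⟨⟨U, hU⟩, fun V hV _ => h₃ V hV ⟨inv V.hom ≫ m, ?_, ?_⟩⟩, m, hm, rfl, h₃⟩
      · exact hM.comp _ _ (hM.iso _ inferInstance) hm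
      · exact IsIso.hom_inv_id_assoc _ _
    · rintro ⟨⟨⟨U, hU⟩, _⟩, m, hm, rfl, h⟩
      refine ⟨(hS' _).2 ⟨U, hU, m, hm, rfl⟩, fun hΨ => ?_⟩
      obtain ⟨V, hV, hq⟩ := (hW' ⟨U, hU⟩ m).1 hΨ
      exact h V hV hq
  obtain ⟨n, ⟨e⟩⟩ := Finite.exists_equiv_fin S'
  have hQ : ∀ U : S, ∃ k : ℕ, Nonempty (W U ≃ Fin k) := fun U => by
    have := (hW U).to_subtype
    exact Finite.exists_equiv_fin _
  choose Q hQ using hQ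
  have eQ : ∀ U : S, W U ≃ Fin (Q U) := fun U => (hQ U).some
  refine ⟨n, fun i => (e.symm i).1.1.right, fun i => (e.symm i).1.1.hom, fun i => Q (e.symm i).1,
    fun i q => ((eQ (e.symm i).1).symm q).1.right, fun i q => ((eQ (e.symm i).1).symm q).1.hom,
    ?_, ?_, ?_⟩
  · obtain ⟨G, p, hp⟩ := hsat
    obtain ⟨U, -⟩ := (hform p).1 hp
    exact Fin.pos (e U)
  · exact fun i q => (e.symm i).2 _ ((eQ (e.symm i).1).symm q).2
  · intro G p
    rw [hform, AC.sat_disj, e.symm.surjective.exists]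
    refine exists_congr fun i => exists_congr fun m => and_congr_right fun _ =>
      and_congr_right fun _ => ?_
    simp only [AC.Sat, AC.sat_nac]
    exact ⟨fun h q => h _ ((eQ _).symm q).2, fun h V hV => by
      obtain ⟨q, hq⟩ := (eQ _).symm.surjective ⟨V, hV⟩
      obtain rfl : ((eQ _).symm q).1 = V := congrArg Subtype.val hq
      exact h q⟩

end FinitelyWitnessed

/-! ### Finiteness of initial conflicts -/

section

variable {fin : ObjectProperty C}

theorem exists_mono_factorization (hM : IsMAdhesive M) (hE' : HasUniquePairFactorization M E')
    (hfin : IsFinitenessClass M E' fin) {A B G : C} (hA : fin A) (hB : fin B) (f : A ⟶ G)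
    (g : B ⟶ G) :
    ∃ (X : C) (e₁ : A ⟶ X) (e₂ : B ⟶ X) (m : X ⟶ G),
      fin X ∧ M m ∧ Mono m ∧ e₁ ≫ m = f ∧ e₂ ≫ m = g := by
  obtain ⟨X, e₁, e₂, m, he, hm, h₁, h₂⟩ := hE'.exists_fac f g
  exact ⟨X, e₁, e₂, m, hfin.overlap _ _ he hA hB, hm, hM.mono m hm, h₁, h₂⟩

theorem fin_of_iso (hM : IsMAdhesive M) (hfin : IsFinitenessClass M E' fin) {A B : C}
    (f : A ⟶ B) [IsIso f] (hA : fin A) : fin B :=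
  hfin.subobject (inv f) (hM.iso _ inferInstance) hA

theorem fin_of_splitEpi (hM : IsMAdhesive M) (hfin : IsFinitenessClass M E' fin) {A B : C}
    (s : B ⟶ A) (m : A ⟶ B) [Mono m] (h : IsIso (s ≫ m)) (hA : fin A) : fin B := by
  have : IsSplitEpi m := ⟨⟨inv (s ≫ m) ≫ s, by simp⟩⟩
  have := isIso_of_mono_of_isSplitEpi m
  exact fin_of_iso hM hfin m hA

/-- The factorization of the two injections through a finite `X` has a monic second part, which is
split by the copairing and hence an isomorphism. -/
theorem fin_coprod [HasBinaryCoproducts C] (hM : IsMAdhesive M)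
    (hE' : HasUniquePairFactorization M E') (hfin : IsFinitenessClass M E' fin) {A B : C}
    (hA : fin A) (hB : fin B) : fin (A ⨿ B) := by
  obtain ⟨X, e₁, e₂, m, hX, -, _, h₁, h₂⟩ := exists_mono_factorization hM hE' hfin hA hB
    (coprod.inl : A ⟶ A ⨿ B) coprod.inr
  have : coprod.desc e₁ e₂ ≫ m = 𝟙 _ := by
    ext <;> simp [h₁, h₂]
  exact fin_of_splitEpi hM hfin (coprod.desc e₁ e₂) m (by rw [this]; infer_instance) hX

theorem TransformationPair.IsPlainInitialConflict.fin_source (hM : IsMAdhesive M)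
    (hE' : HasUniquePairFactorization M E') (hfin : IsFinitenessClass M E' fin)
    {p₁ p₂ : PlainRule M} (h₁ : fin p₁.L) (h₂ : fin p₂.L) {tp : TransformationPair p₁ p₂}
    (h : tp.IsPlainInitialConflict) : fin tp.G := by
  obtain ⟨-, tpI, ε, hε, hiso⟩ := h
  have hεf := hε.isIso_f hiso
  obtain ⟨X, e₁, e₂, m, hX, hm, _, w₁, w₂⟩ :=
    exists_mono_factorization hM hE' hfin h₁ h₂ tp.t₁.o tp.t₂.o
  obtain ⟨t₁, ⟨ε₁⟩⟩ := tp.t₁.exists_restriction hM e₁ m hm w₁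
  obtain ⟨t₂, ⟨ε₂⟩⟩ := tp.t₂.exists_restriction hM e₂ m hm w₂
  -- The pair restricted to the joint image `X` of the matches is embedded in `tp` by `m`, so `ε.f`
  -- factors through `m`. As `ε.f` is invertible, `m` is split epi.
  obtain ⟨ψ, hψ, -⟩ := hε ⟨X, t₁, t₂⟩ ⟨m, ε₁, ε₂⟩
  refine fin_of_splitEpi hM hfin (inv ε.f ≫ ψ.f) m ?_ hX
  have hψ' : ψ.f ≫ m = ε.f := hψ
  rw [Category.assoc, hψ']
  infer_instance

theorem TransformationPair.IsInitialIndependent.fin_source [HasBinaryCoproducts C] (hM : IsMAdhesive M)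
    (hE' : HasUniquePairFactorization M E') (hfin : IsFinitenessClass M E' fin)
    {p₁ p₂ : PlainRule M} (h₁ : fin p₁.L) (h₂ : fin p₂.L) {tp : TransformationPair p₁ p₂}
    (h : tp.IsInitialIndependent) : fin tp.G := by
  obtain ⟨-, ε, hε, -⟩ := h
  exact hfin.subobject ε.f (hM.iso _ hε) (fin_coprod hM hE' hfin h₁ h₂)

/-! ### The conditions of a symbolic transformation pair -/

/-- The only shift of `true` is `true`. The explicit syntactic form is needed because `Left` is
applied to it next: `IsLeft.sat_iff` covers only morphisms underlying a double pushout, whereas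
regularity concerns all morphisms out of `K`. -/
theorem IsShift.exists_of_nac {P X P' : C} {a : P ⟶ X} {b : P ⟶ P'} {s : AC P'}
    (h : IsShift M E' (AC.nac a) b s) :
    ∃ (n : ℕ) (o : Fin n → Overlap M E' b a),
      s = AC.neg (AC.disj n fun k => AC.ex (o k).inl (AC.tt (o k).pt)) := by
  obtain ⟨s', ⟨n, o, -, t, ht, rfl⟩, rfl⟩ := h
  refine ⟨n, o, ?_⟩
  congr
  funext k
  obtain ⟨u, -, hu⟩ := ht k
  rw [hu, AC.tt, Subsingleton.elim u Fin.elim0]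

theorem IsLeft.finitelyWitnessed (hM : IsMAdhesive M) (hfin : IsFinitenessClass M E' fin)
    {R X I L : C} {a : R ⟶ X} {l : I ⟶ L} {r : I ⟶ R} {s : AC L}
    (h : IsLeft (AC.ex a (AC.tt X)) l r s) (hl : M l) (hr : M r) (hL : fin L) (hX : fin X) :
    FinitelyWitnessed M fin fun G (p : L ⟶ G) => AC.Sat M s p := by
  rcases h with ⟨Z, Y, z, r', l', b, t, sq₁, sq₂, ⟨u, -, rfl⟩, rfl⟩ | ⟨-, rfl⟩
  -- `Z` is an `M`-subobject of `X`, and `Y` is a pushout of `L` and `Z` along the `M`-morphism `l`.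
  · have hZ := hfin.subobject r' (hM.pushout sq₁ hr) hX
    refine (FinitelyWitnessed.of_morphism b (hfin.pushout sq₂ hl hL hZ)).congr fun G p => ?_
    exact exists_congr fun m => and_congr_right fun _ =>
      ⟨And.left, fun h => ⟨h, fun i => i.elim0⟩⟩
  · exact FinitelyWitnessed.of_false.congr fun G p => iff_of_false (AC.sat_ff p) id

theorem IsLeft.finitelyWitnessed_of_isShift (hM : IsMAdhesive M)
    (hfin : IsFinitenessClass M E' fin) {L₀ I L R : C} {J : ℕ} {N : Fin J → C}
    {n : ∀ j, L₀ ⟶ N j} {b : L₀ ⟶ R} {s : AC R} {l : I ⟶ L} {r : I ⟶ R} {u : AC L}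
    (hs : IsShift M E' (AC.conj J fun j => AC.nac (n j)) b s) (hu : IsLeft s l r u)
    (hl : M l) (hr : M r) (hN : ∀ j, fin (N j)) (hR : fin R) (hL : fin L) :
    FinitelyWitnessed M fin fun G (p : L ⟶ G) => ¬ AC.Sat M u p := by
  obtain ⟨s', hs', rfl⟩ := hs
  obtain ⟨u', hu', rfl⟩ := hu
  have key : ∀ j, FinitelyWitnessed M fin fun G (p : L ⟶ G) => ¬ AC.Sat M (u' j) p := by
    intro j
    obtain ⟨k, o, hk⟩ := (hs' j).exists_of_nac
    have hj := hu' j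
    rw [hk] at hj
    -- The layers removed are the outer negation and the negation, conjunction and negations that
    -- encode the disjunction.
    obtain ⟨_, ⟨_, ⟨v, hv, rfl⟩, rfl⟩, hj⟩ := hj
    choose w hw hvw using hv
    obtain rfl : v = fun i => AC.neg (w i) := funext hvw
    refine (FinitelyWitnessed.exists_of_finite fun i => (hw i).finitelyWitnessed hM hfin hl hr hL
      (hfin.overlap _ _ (o i).mem hR (hN j))).congr fun G p => ?_
    rw [hj]
    simp [AC.Sat]
  exact (FinitelyWitnessed.exists_of_finite key).congr fun G p => by simp [AC.Sat]

theorem IsConflictComponent.finitelyWitnessed (hM : IsMAdhesive M)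
    (hE' : HasUniquePairFactorization M E') (hfin : IsFinitenessClass M E' fin)
    {L : C} {p : PlainRule M} {K : C} (t : Step p K) {J : ℕ} {N : Fin J → C}
    {n : ∀ j, L ⟶ N j} {o : L ⟶ K} {u : AC K}
    (hu : IsConflictComponent M E' (AC.conj J fun j => AC.nac (n j)) o t.k t.c u)
    (hN : ∀ j, fin (N j)) (hK : fin K) (hR : fin p.R) :
    FinitelyWitnessed M fin fun G (q : K ⟶ G) => ¬ AC.Sat M u q := by
  rcases hu with ⟨d, -, s, hs, hu⟩ | ⟨-, rfl⟩
  · refine hu.finitelyWitnessed_of_isShift hM hfin hs (t.k_mem hM) (t.c_mem hM) hN ?_ hK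
    exact hfin.pushout t.right p.r_mem hR (hfin.subobject t.k (t.k_mem hM) hK)
  -- If the match does not factor through `D`, then `u` is `false` and its negation holds for every
  -- morphism.
  · exact (FinitelyWitnessed.of_true hE' hM hfin hK).congr fun G q =>
      iff_of_true (AC.sat_ff q) trivial

theorem IsShift.finitelyWitnessed (hM : IsMAdhesive M) (hE' : HasUniquePairFactorization M E')
    (hfin : IsFinitenessClass M E' fin) {L K : C} {J : ℕ} {N : Fin J → C} {n : ∀ j, L ⟶ N j}
    {o : L ⟶ K} {s : AC K} (hs : IsShift M E' (AC.conj J fun j => AC.nac (n j)) o s)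
    (hN : ∀ j, fin (N j)) (hK : fin K) :
    FinitelyWitnessed M fin fun G (p : K ⟶ G) => ¬ AC.Sat M s p := by
  refine (FinitelyWitnessed.exists_of_finite fun j =>
    FinitelyWitnessed.shift hM hE' hfin o (n j) hK (hN j)).congr fun G p => ?_
  rw [hs.sat_iff hM hE']
  simp only [AC.Sat, AC.sat_nac, not_forall, not_not]

/-- A conflict component that is satisfied by an extension morphism yields one half of parallel
independence of the extended transformation pair. -/
theorem IsConflictComponent.exists_of_sat (hM : IsMAdhesive M)
    (hE' : HasUniquePairFactorization M E') {L : C} {ac : AC L} {p : PlainRule M} {K G : C}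
    {t : Step p K} {t' : Step p G} {f : K ⟶ G} (ε : StepExtension t t' f) {o : L ⟶ K} {u : AC K}
    (hu : IsConflictComponent M E' ac o t.k t.c u) (hf : AC.Sat M u f) :
    ∃ d : L ⟶ t'.D, d ≫ t'.k = o ≫ f ∧ AC.Sat M ac (d ≫ t'.c) := by
  rcases hu with ⟨d, hd, s, hs, hu⟩ | ⟨-, rfl⟩
  · refine ⟨d ≫ ε.d, ?_, ?_⟩
    · rw [Category.assoc, ← ε.left.w, ← Category.assoc, hd]
    · rw [hu.sat_iff hM (t.k_mem hM) (t.c_mem hM) ε.left ε.right, hs.sat_iff hM hE'] at hf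
      rwa [Category.assoc, ← ε.right.w, ← Category.assoc]
  · exact absurd hf (AC.sat_ff f)

/-- The witness is the extension morphism into a conflict of the unfolding: if it satisfied both
conflict components, the extended pair would be parallel independent. -/
theorem SymbolicPair.exists_sat (hM : IsMAdhesive M) (hE' : HasUniquePairFactorization M E')
    {ρ₁ ρ₂ : Rule M} (stp : SymbolicPair E' ρ₁ ρ₂) (h : stp.ConflictInducing) :
    ∃ (G : C) (f : stp.tp.G ⟶ G), AC.Sat M stp.acK f ∧ AC.Sat M stp.acStar f := by
  obtain ⟨tp, ⟨⟨h₁, h₂⟩, ⟨ε⟩⟩, hconf⟩ := h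
  obtain ⟨s₁, s₂, hs₁, hs₂, hK⟩ := stp.acK_spec
  obtain ⟨u₁₂, u₂₁, hu₁₂, hu₂₁, hstar⟩ := stp.acStar_spec
  refine ⟨tp.G, ε.f, ?_, ?_⟩
  · rw [hK, AC.sat_and, hs₁.sat_iff hM hE', hs₂.sat_iff hM hE', ε.ext₁.match_comm,
      ε.ext₂.match_comm]
    exact ⟨h₁, h₂⟩
  · rw [hstar, AC.Sat, AC.sat_and]
    rintro ⟨hs₁₂, hs₂₁⟩
    obtain ⟨d₁₂, hd₁₂, hac₁⟩ := hu₁₂.exists_of_sat hM hE' ε.ext₂ hs₁₂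
    obtain ⟨d₂₁, hd₂₁, hac₂⟩ := hu₂₁.exists_of_sat hM hE' ε.ext₁ hs₂₁
    exact hconf ⟨⟨d₁₂, hd₁₂.trans ε.ext₁.match_comm, hac₁⟩,
      ⟨d₂₁, hd₂₁.trans ε.ext₂.match_comm, hac₂⟩⟩

end

end

end MAdhesive

/-! ### Regularity of initial conflicts -/

theorem mainTheorem6 {C : Type u} [Category.{v} C] [HasBinaryCoproducts C]
    (M : MorphismProperty C) (hM : MAdhesive.IsMAdhesive M)
    (E' : MAdhesive.PairClass C) (hE' : MAdhesive.HasUniquePairFactorization M E')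
    (fin : ObjectProperty C) (hfin : MAdhesive.IsFinitenessClass M E' fin)
    (𝓡 : Set (MAdhesive.Rule M)) (h𝓡 : MAdhesive.HasInitialPairsForConflicts 𝓡)
    (ρ₁ ρ₂ : MAdhesive.Rule M) (hρ₁ : ρ₁ ∈ 𝓡) (hρ₂ : ρ₂ ∈ 𝓡)
    (hL₁ : fin ρ₁.L) (hR₁ : fin ρ₁.R) (hL₂ : fin ρ₂.L) (hR₂ : fin ρ₂.R)
    (J₁ : ℕ) (N₁ : Fin J₁ → C) (n₁ : ∀ j, ρ₁.L ⟶ N₁ j) (hN₁ : ∀ j, fin (N₁ j))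
    (hac₁ : ρ₁.ac = MAdhesive.AC.conj J₁ fun j => MAdhesive.AC.nac (n₁ j))
    (J₂ : ℕ) (N₂ : Fin J₂ → C) (n₂ : ∀ j, ρ₂.L ⟶ N₂ j) (hN₂ : ∀ j, fin (N₂ j))
    (hac₂ : ρ₂.ac = MAdhesive.AC.conj J₂ fun j => MAdhesive.AC.nac (n₂ j))
    (stp : MAdhesive.SymbolicPair E' ρ₁ ρ₂) (hstp : stp.IsInitialConflict) :
    stp.IsRegular ∧
    ∃ (n : ℕ) (X : Fin n → C) (a : ∀ i, stp.tp.G ⟶ X i) (Q : Fin n → ℕ)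
      (Y : ∀ i, Fin (Q i) → C) (b : ∀ i q, X i ⟶ Y i q),
      0 < n ∧ (∀ i q, ¬ IsIso (b i q)) ∧
      MAdhesive.AC.Equivalent M (MAdhesive.AC.and stp.acK stp.acStar)
        (MAdhesive.AC.disj n fun i => MAdhesive.AC.ex (a i)
          (MAdhesive.AC.conj (Q i) fun q => MAdhesive.AC.nac (b i q))) := by
  have hK : fin stp.tp.G := hstp.2.elim (fun h => h.fin_source hM hE' hfin hL₁ hL₂)
    fun h => h.fin_source hM hE' hfin hL₁ hL₂
  obtain ⟨G, f, hf⟩ := stp.exists_sat hM hE' hstp.1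
  obtain ⟨s₁, s₂, hs₁, hs₂, hacK⟩ := stp.acK_spec
  obtain ⟨u₁₂, u₂₁, hu₁₂, hu₂₁, hstar⟩ := stp.acStar_spec
  rw [hac₁] at hs₁ hu₁₂
  rw [hac₂] at hs₂ hu₂₁
  have hneg := (hs₁.finitelyWitnessed hM hE' hfin hN₁ hK).or
    (hs₂.finitelyWitnessed hM hE' hfin hN₂ hK)
  have hpos := (hu₁₂.finitelyWitnessed hM hE' hfin stp.tp.t₂ hN₁ hK hR₂).or
    (hu₂₁.finitelyWitnessed hM hE' hfin stp.tp.t₁ hN₂ hK hR₁)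
  have hiff : ∀ ⦃G : C⦄ (p : stp.tp.G ⟶ G),
      MAdhesive.AC.Sat M (MAdhesive.AC.and stp.acK stp.acStar) p ↔
        (¬ MAdhesive.AC.Sat M u₁₂ p ∨ ¬ MAdhesive.AC.Sat M u₂₁ p) ∧
        ¬ (¬ MAdhesive.AC.Sat M s₁ p ∨ ¬ MAdhesive.AC.Sat M s₂ p) := by
    intro G p
    rw [MAdhesive.AC.sat_and, hacK, hstar, MAdhesive.AC.Sat, MAdhesive.AC.sat_and,
      MAdhesive.AC.sat_and]
    tauto
  obtain ⟨n, X, a, Q, Y, b, hn, hb, h⟩ := hpos.exists_regular_form hM hE' hfin hneg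
    ⟨G, f, (hiff f).1 ((MAdhesive.AC.sat_and _ _ f).2 hf)⟩
  have hequiv := fun (G : C) (p : stp.tp.G ⟶ G) => (hiff p).trans (h p)
  -- By definition `nac b` is `¬∃(b, true)`, so the second form is the regular form with every `d i
  -- j` equal to `true`.
  exact ⟨⟨n, X, a, Q, Y, b, fun i q => MAdhesive.AC.tt (Y i q), hn, hb, hequiv⟩,
    n, X, a, Q, Y, b, hn, hb, hequiv⟩
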